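/- Let $\Gamma$ be a torsion-free, finitely generated nilpotent group. A Mal'cev basis of $\Gamma$ is a tuple $(a_1,\ldots,a_m)\in\Gamma^m$ such that every $g\in\Gamma$ can be written uniquely as $g=a_1^{x_1}\cdots a_m^{x_m}$ with $(x_1,\ldots,x_m)\in\mathbb{Z}^m$, and such that the subgroups $\Gamma_i=\langle a_i,\ldots,a_m\rangle$ form a central series of $\Gamma$, that is, $\Gamma_1=\Gamma$, $\Gamma_{m+1}=\{e\}$ and $[\Gamma,\Gamma_i]\subseteq\Gamma_{i+1}$ for $1\le i\le m$. The number $m$ is called the Hirsch length of $\Gamma$ (it does not depend on the basis), and if $m\ge 1$ the map $\alpha:\Gamma\to\mathbb{Z}$, $\alpha(a_1^{x_1}\cdots a_m^{x_m})=x_1$, is a homomorphism, called the canonical homomorphism with respect to $(a_1,\ldots,a_m)$. Theorem. Let $\Gamma$ be a torsion-free, finitely generated nilpotent group of Hirsch length at least $2$, and let $\alpha\in\operatorname{Hom}(\Gamma,\mathbb{Z})$ be the canonical homomorphism with respect to some Mal'cev basis of $\Gamma$. Let $\kappa_\alpha:\ker(\alpha)\to\Gamma$ be the inclusion. Then there is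 a class $[\sigma]\in H^2(\Gamma;\mathbb{Z})$ (trivial action on $\mathbb{Z}$) that is skinny with respect to $\alpha$, i.e. $\kappa_\alpha^*([\sigma])=0$ in $H^2(\ker(\alpha);\mathbb{Z})$, and that is non-torsion, i.e. $n[\sigma]\neq 0$ for every integer $n\neq 0$. -/

import Mathlib

universe u

namespace Malcev

section Basis

variable {Γ : Type u} [Group Γ] {m : ℕ}

/-- The ordered product `a₁ ^ x₁ ⋯ aₘ ^ xₘ`. -/
def orderedProd (a : Fin m → Γ) (x : Fin m → ℤ) : Γ :=
  (List.ofFn fun i => a i ^ x i).prod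

/-- The subgroup generated by all but the first `k` entries of `a`; it is trivial for `k ≥ m`. -/
def tailSubgroup (a : Fin m → Γ) (k : ℕ) : Subgroup Γ :=
  Subgroup.closure {g | ∃ j : Fin m, k ≤ (j : ℕ) ∧ a j = g}

/-- `a` is a Mal'cev basis of `Γ`: every element has a unique canonical form, and the subgroups
`⟨aᵢ, …, aₘ⟩` form a central series. -/
structure IsMalcevBasis (a : Fin m → Γ) : Prop where
  existsUnique_orderedProd (g : Γ) : ∃! x : Fin m → ℤ, orderedProd a x = g
  isDescendingCentralSeries : Subgroup.IsDescendingCentralSeries (tailSubgroup a)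

theorem orderedProd_update (a : Fin m → Γ) (x : Fin m → ℤ) (k : Fin m) (z : ℤ)
    (hx : ∀ i ≤ k, x i = 0) :
    orderedProd a (Function.update x k z) = a k ^ z * orderedProd a x := by
  induction m with
  | zero => exact k.elim0
  | succ m ih =>
    unfold orderedProd at ih ⊢
    rw [List.ofFn_succ, List.ofFn_succ, List.prod_cons, List.prod_cons]
    refine Fin.cases (fun hx => ?_) (fun k hx => ?_) k hx
    · simp [hx 0 le_rfl, Fin.succ_ne_zero]
    · have h0 : x 0 = 0 := hx 0 (Fin.zero_le _)
      have key := ih (fun i => a i.succ) (fun i => x i.succ) k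
        (fun i hi => hx _ (Fin.succ_le_succ_iff.2 hi))
      have hne : (0 : Fin (m + 1)) ≠ k.succ := (Fin.succ_ne_zero k).symm
      rw [Function.update_of_ne hne, h0, zpow_zero, one_mul, one_mul, ← key]
      congr 2
      funext i
      by_cases hik : i = k
      · subst hik; simp
      · rw [Function.update_of_ne hik, Function.update_of_ne (by simpa using hik)]

theorem tailSubgroup_succ_le (a : Fin m → Γ) (k : ℕ) :
    tailSubgroup a (k + 1) ≤ tailSubgroup a k :=
  Subgroup.closure_mono fun _ ⟨j, hj, h⟩ => ⟨j, by omega, h⟩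

namespace IsMalcevBasis

variable {a : Fin m → Γ}

theorem normal_tailSubgroup (ha : IsMalcevBasis a) (k : ℕ) : (tailSubgroup a k).Normal := by
  refine ⟨fun x hx g => ?_⟩
  have h := tailSubgroup_succ_le a k
    (ha.isDescendingCentralSeries.2 x⁻¹ k (inv_mem hx) g)
  have h2 := mul_mem hx h
  rw [commutatorElement_def] at h2
  simpa [mul_assoc] using h2

theorem exists_of_mem_tailSubgroup (ha : IsMalcevBasis a) {k : ℕ} (hk : k ≤ m) {g : Γ}
    (hg : g ∈ tailSubgroup a k) :
    ∃ x : Fin m → ℤ, (∀ i : Fin m, (i : ℕ) < k → x i = 0) ∧ orderedProd a x = g := by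
  induction hk using Nat.decreasingInduction generalizing g with
  | self =>
    have h : tailSubgroup a m = ⊥ := by
      rw [tailSubgroup, Subgroup.closure_eq_bot_iff]
      rintro _ ⟨j, hj, -⟩
      omega
    rw [h, Subgroup.mem_bot] at hg
    exact ⟨0, fun _ _ => rfl, by simp [orderedProd, hg]⟩
  | of_succ k hk ih =>
    have hle : tailSubgroup a k ≤ Subgroup.zpowers (a ⟨k, hk⟩) ⊔ tailSubgroup a (k + 1) := by
      rw [tailSubgroup, Subgroup.closure_le]
      rintro _ ⟨j, hj, rfl⟩
      rcases hj.eq_or_lt with h | h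
      · have : j = ⟨k, hk⟩ := Fin.ext h.symm
        subst this
        exact Subgroup.mem_sup_left (Subgroup.mem_zpowers _)
      · exact Subgroup.mem_sup_right (Subgroup.subset_closure ⟨j, h, rfl⟩)
    have := ha.normal_tailSubgroup (k + 1)
    obtain ⟨y, hy, h, hh, rfl⟩ := Subgroup.mem_sup_of_normal_right.1 (hle hg)
    obtain ⟨z, rfl⟩ := Subgroup.mem_zpowers_iff.1 hy
    obtain ⟨x, hx, rfl⟩ := ih hh
    refine ⟨Function.update x ⟨k, hk⟩ z, fun i hi => ?_, ?_⟩
    · rw [Function.update_of_ne (by rintro rfl; simp at hi)]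
      exact hx i (by omega)
    · exact orderedProd_update a x _ z fun i hi => hx i (Nat.lt_succ_of_le hi)

/-- The exponents in the canonical form of `g`. -/
noncomputable def coords (ha : IsMalcevBasis a) (g : Γ) : Fin m → ℤ :=
  (ha.existsUnique_orderedProd g).choose

theorem orderedProd_coords (ha : IsMalcevBasis a) (g : Γ) : orderedProd a (ha.coords g) = g :=
  (ha.existsUnique_orderedProd g).choose_spec.1

theorem coords_orderedProd (ha : IsMalcevBasis a) (x : Fin m → ℤ) :
    ha.coords (orderedProd a x) = x :=
  ((ha.existsUnique_orderedProd (orderedProd a x)).choose_spec.2 x rfl).symm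

theorem exists_eq_zpow_mul (ha : IsMalcevBasis a) (hm : 0 < m) (g : Γ) :
    ∃ u ∈ tailSubgroup a 1, g = a ⟨0, hm⟩ ^ ha.coords g ⟨0, hm⟩ * u := by
  set x := ha.coords g with hx
  refine ⟨orderedProd a (Function.update x ⟨0, hm⟩ 0), ?_, ?_⟩
  · refine Subgroup.list_prod_mem _ fun y hy => ?_
    obtain ⟨i, rfl⟩ := List.mem_ofFn.1 hy
    by_cases hi : i = ⟨0, hm⟩
    · subst hi; simp
    · have h1 : 1 ≤ (i : ℕ) := Nat.one_le_iff_ne_zero.2 fun h => hi (Fin.ext h)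
      have h2 : a i ∈ tailSubgroup a 1 := Subgroup.subset_closure ⟨i, h1, rfl⟩
      exact Subgroup.zpow_mem _ h2 _
  · rw [← orderedProd_update, Function.update_idem, Function.update_eq_self, hx,
      orderedProd_coords]
    intro i hi
    have : i = ⟨0, hm⟩ := Fin.ext (Nat.le_zero.1 hi)
    simp [this]

theorem coords_zpow_mul (ha : IsMalcevBasis a) (hm : 0 < m) (z : ℤ) {u : Γ}
    (hu : u ∈ tailSubgroup a 1) : ha.coords (a ⟨0, hm⟩ ^ z * u) ⟨0, hm⟩ = z := by
  obtain ⟨x, hx, rfl⟩ := ha.exists_of_mem_tailSubgroup hm hu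
  rw [← orderedProd_update a x ⟨0, hm⟩ z fun i hi => hx i (Nat.lt_succ_of_le hi),
    coords_orderedProd, Function.update_self]

/-- The canonical homomorphism `a₁ ^ x₁ ⋯ aₘ ^ xₘ ↦ x₁` with respect to a Mal'cev basis. -/
noncomputable def canonicalHom (ha : IsMalcevBasis a) (hm : 0 < m) : Γ →* Multiplicative ℤ :=
  MonoidHom.mk' (fun g => Multiplicative.ofAdd (ha.coords g ⟨0, hm⟩)) fun g h => by
    have := ha.normal_tailSubgroup 1
    obtain ⟨u, hu, hgu⟩ := ha.exists_eq_zpow_mul hm g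
    obtain ⟨v, hv, hhv⟩ := ha.exists_eq_zpow_mul hm h
    rw [← ofAdd_add]
    congr 1
    set p := ha.coords g ⟨0, hm⟩
    set q := ha.coords h ⟨0, hm⟩
    have hw : (a ⟨0, hm⟩ ^ q)⁻¹ * u * (a ⟨0, hm⟩ ^ q) * v ∈ tailSubgroup a 1 :=
      mul_mem (by simpa using this.conj_mem u hu (a ⟨0, hm⟩ ^ q)⁻¹) hv
    rw [← ha.coords_zpow_mul hm (p + q) hw, hgu, hhv, zpow_add]
    simp only [mul_assoc, mul_inv_cancel_left]

theorem canonicalHom_orderedProd (ha : IsMalcevBasis a) (hm : 0 < m) (x : Fin m → ℤ) :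
    ha.canonicalHom hm (orderedProd a x) = Multiplicative.ofAdd (x ⟨0, hm⟩) := by
  simp [canonicalHom, coords_orderedProd]

end IsMalcevBasis

end Basis

section Cohomology

/-- The integers with trivial `Γ`-action; `ULift` only moves `ℤ` to the universe of `Γ`. -/
noncomputable abbrev trivialInt (Γ : Type u) [Group Γ] : Rep.{u} (ULift.{u} ℤ) Γ :=
  Rep.trivial (ULift.{u} ℤ) Γ (ULift.{u} ℤ)

/-- The second cohomology group `H²(Γ; ℤ)`. -/
noncomputable abbrev H2 (Γ : Type u) [Group Γ] : ModuleCat.{u} (ULift.{u} ℤ) :=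
  groupCohomology (trivialInt Γ) 2

/-- The map `f^* : H²(Λ; ℤ) → H²(Γ; ℤ)` induced by a group homomorphism `f : Γ → Λ`. -/
noncomputable def H2pullback {Γ Λ : Type u} [Group Γ] [Group Λ] (f : Γ →* Λ) : H2 Λ ⟶ H2 Γ :=
  groupCohomology.map (A := trivialInt Λ) (B := trivialInt Γ) f
    (CategoryTheory.CategoryStruct.id (trivialInt Γ)) 2

/-- A class is skinny with respect to `α` if its restriction to `ker α` vanishes. -/
def IsSkinny {Γ : Type u} [Group Γ] (σ : H2 Γ) (α : Γ →* Multiplicative ℤ) : Prop :=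
  H2pullback α.ker.subtype σ = 0

end Cohomology

end Malcev

/-!
Let `t ∈ Γ` with `α t = 1` and let `T` be the automorphism `φ ↦ φ ∘ conj t⁻¹` of
`V = Hom(ker α, ℤ)`. Every `φ ∈ V` is the value at `1` of a unique crossed homomorphism
`c : ℤ → V`, and `(t ^ k * x, t ^ l * y) ↦ c l x` is a 2-cocycle on `Γ = ⟨t⟩ ⋉ ker α`. It vanishes
on `ker α`, and its class has finite order only if some nonzero multiple of `φ` lies in the image
of `T - 1`. As `Γ` is nilpotent, so is `T - 1`, and a nilpotent endomorphism of the nonzero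
torsion-free module `V` has a cokernel which is not torsion.
-/

namespace Malcev

section Unipotent

variable {R V : Type*} [Ring R] [AddCommGroup V] [Module R V]

theorem exists_forall_smul_notMem_range_of_isNilpotent [IsDomain R] [Module.IsTorsionFree R V]
    [Nontrivial V] {f : Module.End R V} (hf : IsNilpotent f) :
    ∃ v : V, ∀ r : R, r ≠ 0 → r • v ∉ LinearMap.range f := by
  by_contra! hrange
  have smul_mem_range_pow (v : V) (i : ℕ) : ∃ r : R, r ≠ 0 ∧ r • v ∈ LinearMap.range (f ^ i) := by
    induction i with
    | zero => exact ⟨1, one_ne_zero, by simp⟩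
    | succ i ih =>
      obtain ⟨r, hr, w, hw⟩ := ih
      obtain ⟨s, hs, u, hu⟩ := hrange w
      refine ⟨s * r, mul_ne_zero hs hr, u, ?_⟩
      rw [pow_succ, Module.End.mul_apply, hu, map_smul, hw, mul_smul]
  obtain ⟨k, hk⟩ := hf
  obtain ⟨v, hv⟩ := exists_ne (0 : V)
  obtain ⟨r, hr, w, hw⟩ := smul_mem_range_pow v k
  rw [hk, LinearMap.zero_apply] at hw
  exact smul_ne_zero hr hv hw.symm

/-- The crossed homomorphism `ℤ → V` with value `v` at `1`, where `1 ∈ ℤ` acts on `V` by `T`: it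
sends `k` to the image of `0` under the `k`-th iterate of the affine map `x ↦ v + T x`. -/
def crossedHom (T : V ≃ₗ[R] V) (v : V) (k : ℤ) : V :=
  ((AffineEquiv.constVAdd R V v * T.toAffineEquiv) ^ k) 0

theorem crossedHom_zero (T : V ≃ₗ[R] V) (v : V) : crossedHom T v 0 = 0 := rfl

theorem crossedHom_one (T : V ≃ₗ[R] V) (v : V) : crossedHom T v 1 = v := by
  simp [crossedHom]

theorem crossedHom_add (T : V ≃ₗ[R] V) (v : V) (k l : ℤ) :
    crossedHom T v (k + l) = crossedHom T v k + (T ^ k) (crossedHom T v l) := by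
  set A := AffineEquiv.constVAdd R V v * T.toAffineEquiv
  have linear_zpow : (A ^ k).linear = T ^ k := map_zpow AffineEquiv.linearHom A k
  have map_eq (x : V) : (A ^ k) x = (T ^ k) x + (A ^ k) 0 := by
    simpa [linear_zpow] using (A ^ k).map_vadd 0 x
  rw [crossedHom, zpow_add, AffineEquiv.coe_mul, Function.comp_apply, map_eq, add_comm]
  rfl

end Unipotent

section Contragredient

theorem isAddTorsionFree_addMonoidHom {A B : Type*} [AddZeroClass A] [AddCommMonoid B]
    [IsAddTorsionFree B] : IsAddTorsionFree (A →+ B) :=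
  ⟨fun _ hn _ _ h => AddMonoidHom.ext fun x => nsmul_right_injective hn (DFunLike.congr_fun h x)⟩

variable {M C : Type*} [Group M] [AddCommGroup C]

/-- The action of the automorphisms of `M` on `Hom(M, C)`, by `φ ↦ φ ∘ θ⁻¹`. -/
def contragredient : MulAut M →* ((Additive M →+ C) ≃ₗ[ℤ] (Additive M →+ C)) where
  toFun θ := (MulEquiv.toAdditive θ).addMonoidHomCongrLeft.toIntLinearEquiv
  map_one' := rfl
  map_mul' _ _ := rfl

theorem contragredient_apply (θ : MulAut M) (φ : Additive M →+ C) (x : M) :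
    contragredient θ φ (.ofMul x) = φ (.ofMul (θ⁻¹ x)) := rfl

theorem contragredient_sub_one_pow_apply (θ : MulAut M) (φ : Additive M →+ C) (x : M) (i : ℕ) :
    (((contragredient θ).toLinearMap - 1) ^ i) φ (.ofMul x) =
      φ (.ofMul ((fun y => θ⁻¹ y / y)^[i] x)) := by
  induction i generalizing x with
  | zero => rfl
  | succ i ih =>
    rw [pow_succ', Module.End.mul_apply, Function.iterate_succ_apply, ← ih, ofMul_div, map_sub,
      ← contragredient_apply]
    rfl

end Contragredient

section Nilpotent

open scoped commutatorElement

variable {Γ : Type*} [Group Γ]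

theorem iterate_commutator_mem_lowerCentralSeries (s x : Γ) (i : ℕ) :
    (fun y => ⁅s, y⁆)^[i] x ∈ (⊤ : Subgroup Γ).lowerCentralSeries i := by
  induction i with
  | zero => exact Subgroup.mem_top x
  | succ i ih =>
    rw [Function.iterate_succ_apply', Subgroup.lowerCentralSeries_succ, Subgroup.commutator_comm]
    exact Subgroup.commutator_mem_commutator (Subgroup.mem_top s) ih

theorem isNilpotent_contragredient_conjNormal_sub_one {C : Type*} [AddCommGroup C]
    [Group.IsNilpotent Γ] (N : Subgroup Γ) [N.Normal] (t : Γ) :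
    IsNilpotent ((contragredient (C := C) (MulAut.conjNormal t : MulAut N)).toLinearMap - 1) := by
  let D (y : N) : N := (MulAut.conjNormal t)⁻¹ y / y
  have coe_D : Function.Semiconj Subtype.val D fun y : Γ => ⁅t⁻¹, y⁆ := fun y => by
    simp [D, ← map_inv, commutatorElement_def, div_eq_mul_inv]
  refine ⟨Group.nilpotencyClass Γ, LinearMap.ext fun φ => AddMonoidHom.ext fun x => ?_⟩
  have iterate_D : D^[Group.nilpotencyClass Γ] x.toMul = 1 := by
    refine Subtype.ext ?_
    rw [coe_D.iterate_right, Subgroup.coe_one, ← Subgroup.mem_bot,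
      ← Subgroup.lowerCentralSeries_nilpotencyClass]
    exact iterate_commutator_mem_lowerCentralSeries _ _ _
  exact (contragredient_sub_one_pow_apply _ φ x.toMul _).trans
    ((congrArg (fun y => φ (.ofMul y)) iterate_D).trans (map_zero φ))

end Nilpotent

section IntCocycle

variable {Γ : Type u} [Group Γ] {f : Γ → Γ → ℤ}

/-- An integer-valued 2-cocycle as a cocycle with values in the trivial module `ℤ`. -/
noncomputable def intCocycle (hf : ∀ g h j, f (g * h) j + f g h = f h j + f g (h * j)) :
    groupCohomology.cocycles₂ (trivialInt Γ) :=
  ⟨fun p => ULift.up (f p.1 p.2), (groupCohomology.mem_cocycles₂_iff _).2 fun g h j =>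
    ULift.down_injective (hf g h j)⟩

theorem H2pullback_H2π_intCocycle_eq_zero {Λ : Type u} [Group Λ] (i : Λ →* Γ)
    (hf : ∀ g h j, f (g * h) j + f g h = f h j + f g (h * j)) (hfi : ∀ x y, f (i x) (i y) = 0) :
    H2pullback i (groupCohomology.H2π (trivialInt Γ) (intCocycle hf)) = 0 := by
  refine (groupCohomology.H2π_comp_map_apply (A := trivialInt Γ) (B := trivialInt Λ) i
    (CategoryTheory.CategoryStruct.id (trivialInt Λ)) (intCocycle hf)).trans ?_
  convert map_zero (groupCohomology.H2π (trivialInt Λ)).hom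
  exact groupCohomology.cocycles₂_ext fun x y => ULift.down_injective (hfi x y)

theorem exists_coboundary_of_nsmul_H2π_intCocycle_eq_zero
    (hf : ∀ g h j, f (g * h) j + f g h = f h j + f g (h * j)) {n : ℕ}
    (hn : n • groupCohomology.H2π (trivialInt Γ) (intCocycle hf) = 0) :
    ∃ β : Γ → ℤ, ∀ g h, n * f g h = β h - β (g * h) + β g := by
  rw [← map_nsmul, groupCohomology.H2π_eq_zero_iff] at hn
  obtain ⟨b, hb⟩ := hn
  refine ⟨fun g => (b g).down, fun g h => ?_⟩
  have hb_down : (b h).down - (b (g * h)).down + (b g).down = n • f g h :=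
    congrArg ULift.down (congrFun hb (g, h))
  rw [hb_down, nsmul_eq_mul]

end IntCocycle

section SkinnyClass

variable {Γ : Type u} [Group Γ] {α : Γ →* Multiplicative ℤ} {t : Γ}
  (ht : α t = Multiplicative.ofAdd 1)

/-- The component `x ∈ ker α` in the decomposition `g = t ^ k * x` given by a section of `α`. -/
def kerPart (g : Γ) : α.ker :=
  ⟨(t ^ (α g).toAdd)⁻¹ * g, by
    rw [MonoidHom.mem_ker, map_mul, map_inv, map_zpow, ht, ← ofAdd_zsmul]
    simp⟩

theorem kerPart_mul (g h : Γ) :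
    kerPart ht (g * h) =
      (MulAut.conjNormal t ^ (α h).toAdd)⁻¹ (kerPart ht g) * kerPart ht h := by
  rw [← map_zpow, ← map_inv]
  ext
  rw [Subgroup.coe_mul, MulAut.conjNormal_apply]
  simp [kerPart, zpow_add, mul_assoc]

theorem kerPart_coe (x : α.ker) : kerPart ht x = x := by
  ext
  simp [kerPart, MonoidHom.mem_ker.1 x.2]

variable (φ : Additive α.ker →+ ℤ)

/-- The 2-cocycle `(t ^ k * x, t ^ l * y) ↦ c l x` on `Γ`, where `c` is the crossed homomorphism
`ℤ → Hom(ker α, ℤ)` with `c 1 = φ`. -/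
def skinnyCocycle (g h : Γ) : ℤ :=
  crossedHom (contragredient (MulAut.conjNormal t)) φ (α h).toAdd (.ofMul (kerPart ht g))

theorem skinnyCocycle_mul_add (g h j : Γ) :
    skinnyCocycle ht φ (g * h) j + skinnyCocycle ht φ g h =
      skinnyCocycle ht φ h j + skinnyCocycle ht φ g (h * j) := by
  simp only [skinnyCocycle, kerPart_mul, map_mul, toAdd_mul, crossedHom_add, ofMul_mul, map_add,
    AddMonoidHom.add_apply, ← map_zpow, contragredient_apply]
  ring

theorem skinnyCocycle_ker_right (g : Γ) (x : α.ker) : skinnyCocycle ht φ g x = 0 := by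
  rw [skinnyCocycle, MonoidHom.mem_ker.1 x.2, toAdd_one, crossedHom_zero, AddMonoidHom.zero_apply]

theorem skinnyCocycle_ker_self (x : α.ker) : skinnyCocycle ht φ x t = φ (.ofMul x) := by
  rw [skinnyCocycle, ht, toAdd_ofAdd, crossedHom_one, kerPart_coe]

/-- The class of `skinnyCocycle` in `H²(Γ; ℤ)`. -/
noncomputable def skinnyClass : H2 Γ :=
  groupCohomology.H2π (trivialInt Γ) (intCocycle (skinnyCocycle_mul_add ht φ))

theorem isSkinny_skinnyClass : IsSkinny (skinnyClass ht φ) α :=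
  H2pullback_H2π_intCocycle_eq_zero _ _ fun x y => skinnyCocycle_ker_right ht φ x y

theorem smul_mem_range_of_nsmul_skinnyClass_eq_zero {n : ℕ} (hn : n • skinnyClass ht φ = 0) :
    (n : ℤ) • φ ∈
      LinearMap.range ((contragredient (MulAut.conjNormal t)).toLinearMap - 1) := by
  obtain ⟨β, hβ⟩ := exists_coboundary_of_nsmul_H2π_intCocycle_eq_zero _ hn
  have map_mul_ker (g : Γ) (x : α.ker) : β (g * x) = β g + β x := by
    have h := hβ g x
    rw [skinnyCocycle_ker_right] at h
    linarith
  let ψ : Additive α.ker →+ ℤ := AddMonoidHom.mk' (fun x => -β x.toMul) fun x y => by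
    rw [toMul_add, Subgroup.coe_mul, map_mul_ker, neg_add]
  refine ⟨ψ, AddMonoidHom.ext fun (x : Additive α.ker) => ?_⟩
  have mul_conj : x.toMul * t = t * ((MulAut.conjNormal t)⁻¹ x.toMul : α.ker) := by
    simp [← map_inv, mul_assoc]
  calc -β ((MulAut.conjNormal t)⁻¹ x.toMul : α.ker) - -β x.toMul
      = β t - β (x.toMul * t) + β x.toMul := by rw [mul_conj, map_mul_ker]; ring
    _ = n * skinnyCocycle ht φ x.toMul t := (hβ _ _).symm
    _ = n * φ x := by rw [skinnyCocycle_ker_self, ofMul_toMul]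

end SkinnyClass

section Basis

variable {Γ : Type u} [Group Γ] {m : ℕ} {a : Fin m → Γ}

theorem orderedProd_mem_tailSubgroup {k : ℕ} {x : Fin m → ℤ}
    (hx : ∀ i : Fin m, (i : ℕ) < k → x i = 0) : orderedProd a x ∈ tailSubgroup a k := by
  refine Subgroup.list_prod_mem _ fun y hy => ?_
  obtain ⟨i, rfl⟩ := List.mem_ofFn.1 hy
  rcases lt_or_ge (i : ℕ) k with hi | hi
  · rw [hx i hi, zpow_zero]
    exact one_mem _
  · have ha : a i ∈ tailSubgroup a k := Subgroup.subset_closure ⟨i, hi, rfl⟩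
    exact zpow_mem ha _

namespace IsMalcevBasis

theorem mem_tailSubgroup_iff (ha : IsMalcevBasis a) {k : ℕ} (hk : k ≤ m) {g : Γ} :
    g ∈ tailSubgroup a k ↔ ∀ i : Fin m, (i : ℕ) < k → ha.coords g i = 0 := by
  refine ⟨fun hg => ?_, fun h => ha.orderedProd_coords g ▸ orderedProd_mem_tailSubgroup h⟩
  obtain ⟨x, hx, rfl⟩ := ha.exists_of_mem_tailSubgroup hk hg
  rwa [coords_orderedProd]

theorem coords_eq_of_zpow_inv_mul_mem (ha : IsMalcevBasis a) {k : Fin m} {g : Γ} {z : ℤ}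
    (h : (a k ^ z)⁻¹ * g ∈ tailSubgroup a (k + 1)) : ha.coords g k = z := by
  obtain ⟨x, hx, hxg⟩ := ha.exists_of_mem_tailSubgroup k.2 h
  rw [← mul_inv_cancel_left (a k ^ z) g, ← hxg,
    ← orderedProd_update a x k z fun i hi => hx i (Nat.lt_succ_of_le hi), coords_orderedProd,
    Function.update_self]

theorem zpow_coords_inv_mul_mem (ha : IsMalcevBasis a) {k : Fin m} {g : Γ}
    (hg : g ∈ tailSubgroup a k) : (a k ^ ha.coords g k)⁻¹ * g ∈ tailSubgroup a (k + 1) := by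
  have coords_eq_zero := (ha.mem_tailSubgroup_iff k.2.le).1 hg
  set x := Function.update (ha.coords g) k 0 with hx
  have x_eq_zero (i : Fin m) (hi : i ≤ k) : x i = 0 := by
    rcases hi.eq_or_lt with rfl | hi
    · exact Function.update_self ..
    · rw [hx, Function.update_of_ne hi.ne, coords_eq_zero i hi]
  have hg_eq : a k ^ ha.coords g k * orderedProd a x = g := by
    rw [← orderedProd_update a x k _ x_eq_zero, hx, Function.update_idem,
      Function.update_eq_self, orderedProd_coords]
  rw [inv_mul_eq_iff_eq_mul.2 hg_eq.symm]
  exact orderedProd_mem_tailSubgroup fun i hi => x_eq_zero i (Nat.le_of_lt_succ hi)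

theorem coords_mul (ha : IsMalcevBasis a) {k : Fin m} {g h : Γ}
    (hg : g ∈ tailSubgroup a k) (hh : h ∈ tailSubgroup a k) :
    ha.coords (g * h) k = ha.coords g k + ha.coords h k := by
  refine ha.coords_eq_of_zpow_inv_mul_mem ?_
  set p := ha.coords g k
  set q := ha.coords h k
  have factor : (a k ^ (p + q))⁻¹ * (g * h) =
      (a k ^ q)⁻¹ * ((a k ^ p)⁻¹ * g) * (a k ^ q)⁻¹⁻¹ * ((a k ^ q)⁻¹ * h) := by
    rw [zpow_add]
    group
  rw [factor]
  exact mul_mem ((ha.normal_tailSubgroup _).conj_mem _ (ha.zpow_coords_inv_mul_mem hg) _)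
    (ha.zpow_coords_inv_mul_mem hh)

theorem coords_self (ha : IsMalcevBasis a) (k : Fin m) : ha.coords (a k) k = 1 :=
  ha.coords_eq_of_zpow_inv_mul_mem (by simp)

theorem canonicalHom_surjective (ha : IsMalcevBasis a) (hm : 0 < m) :
    Function.Surjective (ha.canonicalHom hm) := fun z =>
  ⟨orderedProd a fun _ => z.toAdd, ha.canonicalHom_orderedProd hm _⟩

theorem ker_canonicalHom (ha : IsMalcevBasis a) (hm : 0 < m) :
    (ha.canonicalHom hm).ker = tailSubgroup a 1 := by
  ext g
  rw [ha.mem_tailSubgroup_iff hm]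
  refine ⟨fun hg i hi => ?_, fun h => congrArg Multiplicative.ofAdd (h ⟨0, hm⟩ Nat.zero_lt_one)⟩
  obtain rfl : i = ⟨0, hm⟩ := Fin.ext (Nat.lt_one_iff.1 hi)
  exact congrArg Multiplicative.toAdd hg

theorem nontrivial_hom_ker_canonicalHom (ha : IsMalcevBasis a) (hm : 1 < m) :
    Nontrivial (Additive (ha.canonicalHom (Nat.zero_lt_of_lt hm)).ker →+ ℤ) := by
  rw [ker_canonicalHom]
  let χ : Additive (tailSubgroup a 1) →+ ℤ :=
    AddMonoidHom.mk' (fun x => ha.coords x.toMul ⟨1, hm⟩) fun x y =>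
      ha.coords_mul (k := ⟨1, hm⟩) x.toMul.2 y.toMul.2
  let b : tailSubgroup a 1 := ⟨a ⟨1, hm⟩, Subgroup.subset_closure ⟨_, le_rfl, rfl⟩⟩
  have hχb : χ (.ofMul b) = 1 := ha.coords_self ⟨1, hm⟩
  exact ⟨χ, 0, fun h => one_ne_zero (hχb.symm.trans (DFunLike.congr_fun h _))⟩

end IsMalcevBasis

end Basis

end Malcev

open Malcev in
theorem mainTheorem2_general {Γ : Type u} [Group Γ] [Group.IsNilpotent Γ]
    {α : Γ →* Multiplicative ℤ} (hα : Function.Surjective α)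
    [Nontrivial (Additive α.ker →+ ℤ)] :
    ∃ σ : H2 Γ, IsSkinny σ α ∧ ¬ IsOfFinAddOrder σ := by
  obtain ⟨t, ht⟩ := hα (Multiplicative.ofAdd 1)
  have : IsAddTorsionFree (Additive α.ker →+ ℤ) := isAddTorsionFree_addMonoidHom
  obtain ⟨φ, hφ⟩ := exists_forall_smul_notMem_range_of_isNilpotent
    (isNilpotent_contragredient_conjNormal_sub_one (C := ℤ) α.ker t)
  refine ⟨skinnyClass ht φ, isSkinny_skinnyClass ht φ, fun hfin => ?_⟩
  obtain ⟨n, hn, hnσ⟩ := isOfFinAddOrder_iff_nsmul_eq_zero.1 hfin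
  exact hφ n (Nat.cast_ne_zero.2 hn.ne') (smul_mem_range_of_nsmul_skinnyClass_eq_zero ht φ hnσ)

theorem mainTheorem2 {Γ : Type u} [Group Γ] [Group.FG Γ] [Group.IsNilpotent Γ]
    (torsionFree : ∀ g : Γ, IsOfFinOrder g → g = 1)
    {m : ℕ} (hm : 2 ≤ m) (a : Fin m → Γ) (ha : Malcev.IsMalcevBasis a) :
    ∃ σ : Malcev.H2 Γ,
      Malcev.IsSkinny σ (ha.canonicalHom (Nat.lt_of_lt_of_le Nat.zero_lt_two hm)) ∧
        ¬ IsOfFinAddOrder σ := by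
  have := ha.nontrivial_hom_ker_canonicalHom hm
  exact mainTheorem2_general (ha.canonicalHom_surjective _)
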